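/- **Conventions.** An ideal on a set $M$ is a family of subsets of $M$ closed under subsets and finite unions, containing all finite subsets of $M$ and not containing $M$; $\mathrm{Fin}$ is the ideal of finite subsets of $\omega$. For $J\subseteq\mathcal P(\omega)$ put $J^{\mathrm d}=\{\omega\smallsetminus a: a\in J\}$. A minimum over an empty class is $\infty$. Let $b=\langle b(n):n<\omega\rangle$ be a sequence of non-empty sets. A *property* $\mathcal P$ is a collection of subsets of $\prod_n\mathcal P(b(n))$. For $A\subseteq\mathcal P(\omega)$ let $$\mathfrak d_A(b,\mathcal P)=\min\{|S| : S\in\mathcal P,\ (\forall x\in\textstyle\prod b)(\exists s\in S)\ \{n: x(n)\in s(n)\}\in A\},$$ and, for an ideal $J$ on $\omega$, $\mathfrak{sl}_{\mathrm t}(b,\mathcal P,J)=\mathfrak d_{J^{\mathrm d}}(b,\mathcal P)$ and $\mathfrak{sl}_{\mathrm e}(b,\mathcal P,J)=\mathfrak d_{\mathcal P(\omega)\smallsetminus J}(b,\mathcal P)$. For $\mathcal P$ we use: "$S\subseteq\prod_n[b(n)]^{\le h(n)}$" for $h\in{}^\omega\omega$ (we write $\mathfrak{sl}(b,h,J)$,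 and $\mathfrak{sl}(h,J)$ if all $b(n)=\omega$); for $b(n)=\omega$, "$S\subseteq{}^\omega I$" with $I$ an ideal on $\omega$ (we write $\mathfrak{sl}(I,J)$); and, for $b(n)=\omega$, the property $\star$: for each $n$ the family $\{s(n):s\in S\}$ is contained in some ideal on $\omega$ (we write $\mathfrak{sl}(\star,J)$). For a Hausdorff space $X$, $\mathcal P\text{-}\Gamma(X)$ is the set of all $\langle\langle V_{n,m}:m\in b(n)\rangle:n<\omega\rangle$ with each $V_{n,m}$ open in $X$ and $\{\langle\{m\in b(n):x\notin V_{n,m}\}:n<\omega\rangle : x\in X\}\in\mathcal P$. For $R\subseteq\mathcal P(\omega)$, $X$ is an $\mathrm S_1(\mathcal P\text{-}\Gamma,R\text{-}\Gamma)$-space if for each such sequence there is $d\in\prod b$ with $\{n: x\notin V_{n,d(n)}\}\in R$ for all $x\in X$. $\mathrm{non}(\mathrm S_1(\mathcal P\text{-}\Gamma,R\text{-}\Gamma))$ is the least size of a Hausdorff space that is not such a space. In the first place, $\Gamma_{b,h}$, $\Gamma_h$, $\Gamma$, $I\text{-}\Gamma$, $\Omega$ denote $\mathcal P\text{-}\Gamma$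 for the property "$S\subseteq\prod_n[b(n)]^{\le h(n)}$", the same with all $b(n)=\omega$, "$S\subseteq{}^\omega\mathrm{Fin}$", "$S\subseteq{}^\omega I$", and $\star$ (with all $b(n)=\omega$), respectively. In the second place, $\Gamma$, $J\text{-}\Gamma$, $J\text{-}\Lambda$, $\mathcal O$ denote $R\text{-}\Gamma$ for $R=\mathrm{Fin}$, $R=J$, $R=\mathcal P(\omega)\smallsetminus J^{\mathrm d}$, $R=\mathcal P(\omega)\smallsetminus\{\omega\}$. $\mathfrak b_J$ and $\mathfrak d_J$ are the least sizes of an unbounded and of a dominating family in ${}^\omega\omega$ for the relation $\{n:x(n)\le y(n)\}\in J^{\mathrm d}$. $\mathrm{non}(\mathcal M)$ is the least size of a non-meager set of reals and $\mathrm{cof}(\mathcal N)$ is the cofinality (under inclusion) of the ideal of Lebesgue null sets of reals. **Corollary.** Let $I,J$ be ideals on $\omega$, let $b=\langle b(n):n<\omega\rangle$ be a sequence of non-empty sets, and let $g,h\in{}^\omega\omega$ with $\lim_n g(n)=\infty$ and $h(n)\ge1$ for all but finitely many $n$. Then $$\begin{array}{ll} \mathrm{non}(\mathrm S_1(\Gamma_h,\Gamma))=\mathrm{non}(\mathcal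 M), & \mathrm{non}(\mathrm S_1(\Gamma_g,\mathrm{Fin}\text{-}\Lambda))=\mathrm{cof}(\mathcal N),\\ \mathrm{non}(\mathrm S_1(\Gamma_h,J\text{-}\Gamma))=\mathfrak{sl}_{\mathrm e}(h,J), & \mathrm{non}(\mathrm S_1(\Gamma_h,J\text{-}\Lambda))=\mathfrak{sl}_{\mathrm t}(h,J),\\ \mathrm{non}(\mathrm S_1(\Gamma_{b,h},J\text{-}\Gamma))=\mathfrak{sl}_{\mathrm e}(b,h,J), & \mathrm{non}(\mathrm S_1(\Gamma_{b,h},J\text{-}\Lambda))=\mathfrak{sl}_{\mathrm t}(b,h,J),\\ \mathrm{non}(\mathrm S_1(\Gamma,J\text{-}\Gamma))=\mathfrak b_J, & \mathrm{non}(\mathrm S_1(\Gamma,J\text{-}\Lambda))=\mathfrak d_J,\\ \mathrm{non}(\mathrm S_1(I\text{-}\Gamma,J\text{-}\Gamma))=\mathfrak{sl}_{\mathrm e}(I,J), & \mathrm{non}(\mathrm S_1(I\text{-}\Gamma,J\text{-}\Lambda))=\mathfrak{sl}_{\mathrm t}(I,J),\\ \mathrm{non}(\mathrm S_1(\Omega,J\text{-}\Gamma))=\mathfrak{sl}_{\mathrm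 e}(\star,J), & \mathrm{non}(\mathrm S_1(\Omega,J\text{-}\Lambda))=\mathfrak{sl}_{\mathrm t}(\star,J). \end{array}$$ Moreover, for $J=\mathrm{Fin}$ the family $J\text{-}\Lambda$ can be replaced by $\mathcal O$ in every equality of the right column: in the equality for $\Gamma_g$ if $g(n)\ne0$ for all $n$; in that for $\Gamma_h$ if $h(n)\neq0$ for all $n$; in that for $\Gamma_{b,h}$ if $h(n)\ne0$ for all $n$, every $b(n)$ is countable, and $h(n)<|b(n)|$ for infinitely many $n$; and in those for $\Gamma$, $I\text{-}\Gamma$ and $\Omega$ without further conditions. -/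

import Mathlib

open Cardinal Filter MeasureTheory

universe u

namespace SlalomNumbers

/-! ### Ideals and families of sets -/

/-- `I` is an ideal on the set `M`: closed under subsets and finite unions, containing all finite
subsets of `M`, and proper. -/
structure IsIdealOn {M : Type u} (I : Set (Set M)) : Prop where
  subset_mem : ∀ ⦃s t : Set M⦄, t ∈ I → s ⊆ t → s ∈ I
  union_mem : ∀ ⦃s t : Set M⦄, s ∈ I → t ∈ I → s ∪ t ∈ I
  finite_mem : ∀ ⦃s : Set M⦄, s.Finite → s ∈ I
  univ_notMem : Set.univ ∉ I

/-- The finite union property: `A` is contained in some ideal on `M`. -/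
def HasFUP {M : Type u} (A : Set (Set M)) : Prop :=
  ∃ I : Set (Set M), IsIdealOn I ∧ A ⊆ I

/-- The ideal of finite subsets of `ℕ`. -/
def FinIdeal : Set (Set ℕ) := {s | s.Finite}

/-- The family `Aᵈ` of complements of members of `A` (the dual filter, if `A` is an ideal). -/
def dualFamily {M : Type u} (A : Set (Set M)) : Set (Set M) := {s | sᶜ ∈ A}

/-! ### Minimal cardinalities -/

/-- The least element of a class of cardinals, with value `⊤` (that is, `∞`) if there is none. -/
noncomputable def minCard (S : Set Cardinal.{u}) : WithTop Cardinal.{u} :=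
  sInf ((fun κ : Cardinal.{u} => (κ : WithTop Cardinal.{u})) '' S)

/-- The unbounding number of the relational system `⟨X, Y, r⟩`. -/
noncomputable def unboundingNumber {X Y : Type u} (r : X → Y → Prop) : WithTop Cardinal.{u} :=
  minCard {κ | ∃ F : Set X, (¬ ∃ y : Y, ∀ x ∈ F, r x y) ∧ #F = κ}

/-- The dominating number of the relational system `⟨X, Y, r⟩`. -/
noncomputable def dominatingNumber {X Y : Type u} (r : X → Y → Prop) : WithTop Cardinal.{u} :=
  minCard {κ | ∃ D : Set Y, (∀ x : X, ∃ y ∈ D, r x y) ∧ #D = κ}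

/-- `non(𝓜)`: the least size of a non-meager set of reals. -/
noncomputable def nonMeager : WithTop Cardinal.{0} :=
  unboundingNumber (fun (x : ℝ) (A : {A : Set ℝ // IsMeagre A}) => x ∈ A.1)

/-- `cof(𝓝)`: the cofinality, under inclusion, of the ideal of Lebesgue null sets of reals. -/
noncomputable def cofNull : WithTop Cardinal.{0} :=
  dominatingNumber (fun A B : {A : Set ℝ // volume A = 0} => A.1 ⊆ B.1)

/-- `x ≤ y` modulo `J`. -/
def leMod (J : Set (Set ℕ)) (x y : ℕ → ℕ) : Prop := {n | x n ≤ y n} ∈ dualFamily J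

/-- The bounding number `𝔟_J`. -/
noncomputable def boundingNumberMod (J : Set (Set ℕ)) : WithTop Cardinal.{0} :=
  unboundingNumber (leMod J)

/-- The dominating number `𝔡_J`. -/
noncomputable def dominatingNumberMod (J : Set (Set ℕ)) : WithTop Cardinal.{0} :=
  dominatingNumber (leMod J)

/-! ### Properties of families of slaloms

Given a sequence `b` of sets, a slalom is a member of `∏ n, 𝒫(b n)`, and a property of families of
slaloms is a set of sets of slaloms. -/

/-- The property "`S ⊆ 𝓢(b,h) = ∏ n, [b n]^{≤ h n}`". -/
def boundedBy (b : ℕ → Type u) (h : ℕ → ℕ) : Set (Set (∀ n, Set (b n))) :=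
  {S | ∀ s ∈ S, ∀ n, (s n).encard ≤ h n}

/-- The property "`S ⊆ ∏ n, I`" for a family `I` of subsets of `ℕ`. -/
def valuedIn (I : Set (Set ℕ)) : Set (Set (ℕ → Set ℕ)) :=
  {S | ∀ s ∈ S, ∀ n, s n ∈ I}

/-- The property `⋆`: for every `n`, the family of `n`-th values has the finite union property. -/
def coordFUP (b : ℕ → Type u) : Set (Set (∀ n, Set (b n))) :=
  {S | ∀ n, HasFUP ((fun s : ∀ n, Set (b n) => s n) '' S)}

/-! ### Slalom numbers -/

section

variable {b : ℕ → Type u}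

/-- `𝔡_A(∏ b, P)`: the least size of a family `S` with property `P` such that every `x ∈ ∏ b`
satisfies `{n | x n ∈ s n} ∈ A` for some `s ∈ S`. -/
noncomputable def slalomNumber (A : Set (Set ℕ)) (P : Set (Set (∀ n, Set (b n)))) :
    WithTop Cardinal.{u} :=
  minCard {κ | ∃ S ∈ P, (∀ x : ∀ n, b n, ∃ s ∈ S, {n | x n ∈ s n} ∈ A) ∧ #S = κ}

/-- `𝔰𝔩_t(∏ b, P, J)`, where `A` is the dual filter of `J`. -/
noncomputable def slt (P : Set (Set (∀ n, Set (b n)))) (J : Set (Set ℕ)) :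
    WithTop Cardinal.{u} :=
  slalomNumber (dualFamily J) P

/-- `𝔰𝔩_e(∏ b, P, J)`, where `A` is the family of `J`-positive sets. -/
noncomputable def sle (P : Set (Set (∀ n, Set (b n)))) (J : Set (Set ℕ)) :
    WithTop Cardinal.{u} :=
  slalomNumber Jᶜ P

/-! ### Covers and selection principles -/

/-- `V` is an `R`-`γ`-cover of `X`. -/
def IsGammaCover {X : Type u} (R : Set (Set ℕ)) (V : ℕ → Set X) : Prop :=
  ∀ x : X, {n | x ∉ V n} ∈ R

/-- The family `P`-`Γ` of sequences (indexed by `n`) of sequences `(V n m)` (indexed by `m ∈ b n`)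
of open sets, such that the family of slaloms `n ↦ {m | x ∉ V n m}`, `x ∈ X`, has property `P`. -/
def coverSeqs (P : Set (Set (∀ n, Set (b n)))) (X : Type u) [TopologicalSpace X] :
    Set (∀ n, b n → Set X) :=
  {V | (∀ n m, IsOpen (V n m)) ∧ Set.range (fun (x : X) (n : ℕ) => {m : b n | x ∉ V n m}) ∈ P}

/-- `X` is an `S₁(P-Γ, R-Γ)`-space (trivial covers are allowed). -/
def IsS1Space (P : Set (Set (∀ n, Set (b n)))) (R : Set (Set ℕ))
    (X : Type u) [TopologicalSpace X] : Prop :=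
  ∀ V ∈ coverSeqs P X, ∃ d : ∀ n, b n, IsGammaCover R (fun n => V n (d n))

/-- The critical cardinality of `S₁(P-Γ, R-Γ)`: the least size of a Hausdorff space that is not an
`S₁(P-Γ, R-Γ)`-space. -/
noncomputable def nonS1 (P : Set (Set (∀ n, Set (b n)))) (R : Set (Set ℕ)) :
    WithTop Cardinal.{u} :=
  minCard {κ | ∃ (X : Type u) (_ : TopologicalSpace X), T2Space X ∧ ¬ IsS1Space P R X ∧ #X = κ}

end

/-- `J`-`Λ` is `R`-`Γ` for the family `R = Jᵈᶜ` of sets that are not in the dual filter of `J`. -/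
def large (J : Set (Set ℕ)) : Set (Set ℕ) := (dualFamily J)ᶜ

/-- `𝒪` is `R`-`Γ` for the family `R` of all proper subsets of `ℕ`. -/
def openCover : Set (Set ℕ) := {Set.univ}ᶜ

/-- `Γ_{b,h}` as a property of families of slaloms. -/
abbrev GammaBH (b : ℕ → Type u) (h : ℕ → ℕ) : Set (Set (∀ n, Set (b n))) := boundedBy b h

/-- `Γ_h`, the case where each `b n` is `ℕ`. -/
abbrev GammaH (h : ℕ → ℕ) : Set (Set (ℕ → Set ℕ)) := boundedBy (fun _ => ℕ) h

/-- `Γ`, the case of the ideal of finite sets. -/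
abbrev Gamma : Set (Set (ℕ → Set ℕ)) := valuedIn FinIdeal

/-- `Ω`: sequences of `ω`-covers indexed by `ℕ`, given by the property `⋆`. -/
abbrev Omega : Set (Set (ℕ → Set ℕ)) := coordFUP (fun _ => ℕ)

end SlalomNumbers

open SlalomNumbers

namespace SlalomNumbers

/-! ### Minimal cardinalities -/

/-! A sequence of covers of `X` assigns to each point the slalom of indices whose sets miss it;
conversely, a family `S` of slaloms is a discrete space in which the point `s` has slalom `s`. A
selector `d` fails exactly when the slalom of some point captures it in the sense of `Rᶜ`, so every
critical cardinality is a slalom number (`nonS1_eq_slalomNumber`). What remains is to evaluate some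
of these numbers and to pass from `Fin`-`Λ` to `𝒪`.

For `𝒪`, capture at almost all `n` becomes capture at all `n` after a finite modification of the
slalom. There are countably many modifications and a localizing family is infinite, so its size does
not grow (`nonS1_openCover_eq_slt`). For `Γ`, a finite set and an upper bound of it carry the same
information, which gives `𝔟_J` and `𝔡_J`.

The equality with `non(𝓜)` is Bartoszyński's characterization. Comeagerly many reals have a code
that meets a given function infinitely often. Conversely, slaloms guessing infinitely often yield an
infinitely often equal family (`exists_isInfinitelyEqual_of_slaloms`), this yields a family meeting
every strategy infinitely often (`IsInfinitelyEqual.exists_strategy`), and playing such functions in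
a game of nested intervals produces a non-meager set (`exists_nonmeager_of_strategy`).

For `cof(𝓝)`, slaloms over codes of small sets give null sets by Borel–Cantelli
(`cofNull_le_slt_boundedBy`). Conversely, independent events turn functions into null sets, and a
null set containing many of these is decoded into countably many slaloms by a Baire category
argument (`exists_slaloms_of_null`). The width of the slaloms is then adjusted by guessing blocks of
values (`slt_boundedBy_le_of_tendsto`). -/

lemma minCard_le_minCard {S T : Set Cardinal.{u}} (h : ∀ κ ∈ T, ∃ κ' ∈ S, κ' ≤ κ) :
    minCard S ≤ minCard T := by
  refine le_sInf ?_
  rintro _ ⟨κ, hκ, rfl⟩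
  obtain ⟨κ', hκ', hle⟩ := h κ hκ
  exact (sInf_le (Set.mem_image_of_mem _ hκ')).trans (WithTop.coe_le_coe.2 hle)

/-! ### Selection principles and slalom numbers -/

section

variable {b : ℕ → Type u}

theorem nonS1_eq_slalomNumber (P : Set (Set (∀ n, Set (b n)))) (R : Set (Set ℕ)) :
    nonS1 P R = slalomNumber Rᶜ P := by
  apply le_antisymm
  · refine minCard_le_minCard ?_
    rintro _ ⟨S, hS, hdom, rfl⟩
    refine ⟨#S, ⟨S, ⊥, ?_, ?_, rfl⟩, le_rfl⟩
    · let _ : TopologicalSpace S := ⊥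
      have : DiscreteTopology S := ⟨rfl⟩
      infer_instance
    · let _ : TopologicalSpace S := ⊥
      have : DiscreteTopology S := ⟨rfl⟩
      intro hX
      -- With these sets, the point `s` of the discrete space has slalom `s` itself.
      have hrange : Set.range (fun (x : S) (n : ℕ) => {m : b n | x ∉ {s : S | m ∉ s.1 n}}) = S := by
        simp
      obtain ⟨d, hd⟩ := hX (fun n m => {s : S | m ∉ s.1 n})
        ⟨fun _ _ => isOpen_discrete _, by rw [hrange]; exact hS⟩
      obtain ⟨s, hs, hsd⟩ := hdom d
      apply hsd
      simpa using hd ⟨s, hs⟩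
  · refine minCard_le_minCard ?_
    rintro _ ⟨X, _, -, hX, rfl⟩
    simp only [IsS1Space, not_forall, not_exists] at hX
    obtain ⟨V, hV, hd⟩ := hX
    refine ⟨_, ⟨_, hV.2, ?_, rfl⟩, mk_range_le⟩
    intro x
    have := hd x
    simp only [IsGammaCover, not_forall] at this
    obtain ⟨p, hp⟩ := this
    exact ⟨_, ⟨p, rfl⟩, by simpa using hp⟩

theorem nonS1_eq_sle (P : Set (Set (∀ n, Set (b n)))) (J : Set (Set ℕ)) :
    nonS1 P J = sle P J := nonS1_eq_slalomNumber P J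

theorem nonS1_large_eq_slt (P : Set (Set (∀ n, Set (b n)))) (J : Set (Set ℕ)) :
    nonS1 P (large J) = slt P J := by
  rw [nonS1_eq_slalomNumber, large, compl_compl]; rfl

/-! ### Localization modulo `Fin` and the passage from `Fin`-`Λ` to `𝒪`. -/

theorem mem_dualFamily_finIdeal {A : Set ℕ} :
    A ∈ dualFamily FinIdeal ↔ ∀ᶠ n in atTop, n ∈ A := by
  rw [← Nat.cofinite_eq_atTop]; rfl

theorem mem_compl_finIdeal {A : Set ℕ} : A ∈ FinIdealᶜ ↔ ∃ᶠ n in atTop, n ∈ A := by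
  rw [Nat.frequently_atTop_iff_infinite]; rfl

/-- A family of slaloms that are proper infinitely often and localize every sequence is infinite. -/
theorem infinite_of_localizing [∀ n, Nonempty (b n)] {S : Set (∀ n, Set (b n))}
    (hprop : ∀ s ∈ S, ∃ᶠ n in atTop, s n ≠ Set.univ)
    (hS : ∀ x : ∀ n, b n, ∃ s ∈ S, ∀ᶠ n in atTop, x n ∈ s n) : S.Infinite := by
  intro hfin
  have : Finite S := hfin
  obtain ⟨s₀, hs₀, -⟩ := hS fun n => Classical.arbitrary _
  have : Nonempty S := ⟨⟨s₀, hs₀⟩⟩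
  have hseq : ∀ i : S × ℕ, ∃ n, i.2 ≤ n ∧ i.1.1 n ≠ Set.univ := fun i => by
    obtain ⟨n, hn, h⟩ := frequently_atTop.1 (hprop _ i.1.2) i.2
    exact ⟨n, hn, h⟩
  -- A requirement `(s, N)` asks that `x` escape `s` somewhere beyond `N`; meeting all of them makes
  -- `x` escape each `s` infinitely often.
  obtain ⟨e, he⟩ := exists_surjective_nat (S × ℕ)
  -- pick strictly increasing positions, each serving one requirement
  have hnext : ∀ N k, ∃ n, N ≤ n ∧ (e k).2 ≤ n ∧ (e k).1.1 n ≠ Set.univ := fun N k => by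
    obtain ⟨n, hn, h⟩ := frequently_atTop.1 (hprop _ (e k).1.2) (max N (e k).2)
    exact ⟨n, (le_max_left _ _).trans hn, (le_max_right _ _).trans hn, h⟩
  choose nx h1 h2 h3 using hnext
  let p : ℕ → ℕ := Nat.rec (motive := fun _ => ℕ) (nx 0 0) (fun k r => nx (r + 1) (k + 1))
  have hp : StrictMono p := strictMono_nat_of_lt_succ fun k => h1 (p k + 1) (k + 1)
  have hp2 : ∀ k, (e k).2 ≤ p k ∧ (e k).1.1 (p k) ≠ Set.univ := by
    rintro (_ | k)
    · exact ⟨h2 _ _, h3 _ _⟩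
    · exact ⟨h2 _ _, h3 _ _⟩
  have hx : ∀ n, ∃ y : b n, ∀ k, p k = n → y ∉ (e k).1.1 n := by
    intro n
    rcases Classical.em (∃ k : ℕ, p k = n) with ⟨k, rfl⟩ | hn
    · obtain ⟨y, hy⟩ := (Set.ne_univ_iff_exists_notMem _).1 (hp2 k).2
      exact ⟨y, fun k' hk' => by rw [hp.injective hk']; exact hy⟩
    · exact ⟨Classical.arbitrary _, fun k hk => (hn ⟨k, hk⟩).elim⟩
  choose x hx using hx
  obtain ⟨s, hs, hsx⟩ := hS x
  obtain ⟨N, hN⟩ := eventually_atTop.1 hsx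
  obtain ⟨k, hk⟩ := he (⟨s, hs⟩, N)
  have hb := (hp2 k).1
  have hc := hx (p k) k rfl
  rw [hk] at hb hc
  exact hc (hN _ hb)

/-- The slalom `s` with its first `l.length` values replaced by the singletons given by `l`. -/
def modifySlalom (s : ∀ n, Set (b n)) (l : List (Σ n, b n)) (n : ℕ) : Set (b n) :=
  {y | if n < l.length then l[n]? = some ⟨n, y⟩ else y ∈ s n}

/-- An entry of `l` at place `n` that is tagged with another index yields the empty set, hence only
a subsingleton. -/
theorem modifySlalom_of_lt {s : ∀ n, Set (b n)} {l : List (Σ n, b n)} {n : ℕ}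
    (hn : n < l.length) : (modifySlalom s l n).Subsingleton := by
  intro y hy z hz
  simp only [modifySlalom, hn, if_true, Set.mem_ofPred_eq] at hy hz
  rw [hy] at hz
  simpa using hz

theorem modifySlalom_of_le {s : ∀ n, Set (b n)} {l : List (Σ n, b n)} {n : ℕ}
    (hn : l.length ≤ n) : modifySlalom s l n = s n := by
  simp [modifySlalom, not_lt.2 hn]

/-- `hprop` makes a localizing family infinite, so that it absorbs the countably many finite
modifications; `hmod` keeps the modified family within `P`. -/
theorem nonS1_openCover_eq_slt [∀ n, Nonempty (b n)] [∀ n, Countable (b n)]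
    {P : Set (Set (∀ n, Set (b n)))}
    (hprop : ∀ S ∈ P, ∀ s ∈ S, ∃ᶠ n in atTop, s n ≠ Set.univ)
    (hmod : ∀ S ∈ P, {s | ∃ s' ∈ S, ∃ l, s = modifySlalom s' l} ∈ P) :
    nonS1 P openCover = slt P FinIdeal := by
  rw [nonS1_eq_slalomNumber, openCover, compl_compl]
  apply le_antisymm
  · refine minCard_le_minCard ?_
    rintro _ ⟨S, hSP, hS, rfl⟩
    simp only [mem_dualFamily_finIdeal, Set.mem_ofPred_eq] at hS
    have hinf := infinite_of_localizing (hprop S hSP) hS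
    have hrange : {s | ∃ s' ∈ S, ∃ l, s = modifySlalom s' l} =
        Set.range fun p : S × List (Σ n, b n) => modifySlalom p.1.1 p.2 := by
      ext s
      simp [eq_comm]
    refine ⟨_, ⟨_, hmod S hSP, ?_, rfl⟩, ?_⟩
    · intro x
      obtain ⟨s, hs, hx⟩ := hS x
      obtain ⟨N, hN⟩ := eventually_atTop.1 hx
      refine ⟨_, ⟨s, hs, (List.range N).map fun n => ⟨n, x n⟩, rfl⟩, ?_⟩
      refine Set.eq_univ_of_forall fun n => ?_
      by_cases hn : n < N
      · simp [modifySlalom, hn]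
      · simpa [modifySlalom, hn] using hN n (not_lt.1 hn)
    · rw [hrange]
      refine mk_range_le.trans ?_
      rw [mk_prod, lift_id, lift_id]
      have h1 : ℵ₀ ≤ #S := infinite_iff.1 hinf.to_subtype
      exact (mul_le_mul_right (mk_le_aleph0.trans h1) _).trans (mul_eq_self h1).le
  · refine minCard_le_minCard ?_
    rintro _ ⟨S, hSP, hS, rfl⟩
    refine ⟨_, ⟨S, hSP, fun x => ?_, rfl⟩, le_rfl⟩
    obtain ⟨s, hs, hx⟩ := hS x
    rw [Set.mem_singleton_iff] at hx
    exact ⟨s, hs, by rw [hx, mem_dualFamily_finIdeal]; simp⟩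

theorem modifySlalom_mem {s : ∀ n, Set (b n)} {l : List (Σ n, b n)} {n : ℕ} {I : Set (Set (b n))}
    (hI : IsIdealOn I) (hs : s n ∈ I) : modifySlalom s l n ∈ I := by
  rcases lt_or_ge n l.length with hn | hn
  · exact hI.finite_mem (modifySlalom_of_lt hn).finite
  · rwa [modifySlalom_of_le hn]

theorem nonS1_boundedBy_openCover [∀ n, Nonempty (b n)] [∀ n, Countable (b n)] {h : ℕ → ℕ}
    (h0 : ∀ n, h n ≠ 0) (hb : ∃ᶠ n in atTop, (h n : Cardinal) < #(b n)) :
    nonS1 (boundedBy b h) openCover = slt (boundedBy b h) FinIdeal := by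
  refine nonS1_openCover_eq_slt ?_ ?_
  · intro S hS s hs
    refine hb.mono fun n hn heq => ?_
    have h1 := hS s hs n
    rw [heq, Set.encard_univ] at h1
    have h2 : #(b n) ≤ h n := by
      have hf : Finite (b n) := by
        by_contra hinf
        rw [not_finite_iff_infinite] at hinf
        rw [ENat.card_eq_top_of_infinite] at h1
        exact absurd h1 (by simp)
      have := Fintype.ofFinite (b n)
      rw [ENat.card_eq_coe_fintype_card] at h1
      rw [mk_fintype]
      exact_mod_cast h1
    exact absurd hn (not_lt.2 h2)
  · rintro S hS _ ⟨s, hs, l, rfl⟩ n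
    rcases lt_or_ge n l.length with hn | hn
    · refine (Set.encard_le_one_iff_subsingleton.2 (modifySlalom_of_lt hn)).trans ?_
      exact_mod_cast Nat.one_le_iff_ne_zero.2 (h0 n)
    · rw [modifySlalom_of_le hn]
      exact hS s hs n

end

theorem nonS1_boundedBy_nat_openCover {h : ℕ → ℕ} (h0 : ∀ n, h n ≠ 0) :
    nonS1 (GammaH h) openCover = slt (boundedBy (fun _ => ℕ) h) FinIdeal :=
  nonS1_boundedBy_openCover h0 (Frequently.of_forall fun n => by
    rw [mk_nat]; exact natCast_lt_aleph0)

theorem nonS1_valuedIn_openCover {I : Set (Set ℕ)} (hI : IsIdealOn I) :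
    nonS1 (valuedIn I) openCover = slt (valuedIn I) FinIdeal := by
  refine nonS1_openCover_eq_slt ?_ ?_
  · intro S hS s hs
    exact Frequently.of_forall fun n hn => hI.univ_notMem (hn ▸ hS s hs n)
  · rintro S hS _ ⟨s, hs, l, rfl⟩ n
    exact modifySlalom_mem hI (hS s hs n)

theorem nonS1_coordFUP_openCover :
    nonS1 Omega openCover = slt (coordFUP fun _ => ℕ) FinIdeal := by
  refine nonS1_openCover_eq_slt ?_ ?_
  · intro S hS s hs
    refine Frequently.of_forall fun n hn => ?_
    obtain ⟨I, hI, hSI⟩ := hS n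
    exact hI.univ_notMem (hn ▸ hSI ⟨s, hs, rfl⟩)
  · rintro S hS n
    obtain ⟨I, hI, hSI⟩ := hS n
    refine ⟨I, hI, ?_⟩
    rintro _ ⟨_, ⟨s, hs, l, rfl⟩, rfl⟩
    exact modifySlalom_mem hI (hSI ⟨s, hs, rfl⟩)

/-! ### Finite-set-valued slaloms: `𝔟_J` and `𝔡_J`. -/

theorem isIdealOn_finIdeal : IsIdealOn FinIdeal where
  subset_mem _ _ ht hst := ht.subset hst
  union_mem _ _ hs ht := hs.union ht
  finite_mem _ hs := hs
  univ_notMem := Set.infinite_univ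

theorem sle_finIdeal_eq_boundingNumberMod {J : Set (Set ℕ)} (hJ : IsIdealOn J) :
    sle (valuedIn FinIdeal) J = boundingNumberMod J := by
  apply le_antisymm
  · refine minCard_le_minCard ?_
    rintro _ ⟨F, hF, rfl⟩
    -- The negation of `x n ≤ y n` is strict, hence `Iio`; in the converse direction the `+ 1` after
    -- the supremum plays the same role.
    refine ⟨_, ⟨(fun x n => Set.Iio (x n)) '' F, ?_, fun y => ?_, rfl⟩, mk_image_le⟩
    · rintro _ ⟨x, -, rfl⟩ n
      exact Set.finite_Iio _
    · by_contra! hcon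
      refine hF ⟨y, fun x hx => ?_⟩
      have := hcon _ ⟨x, hx, rfl⟩
      simpa [leMod, dualFamily, Set.compl_ofPred] using this
  · refine minCard_le_minCard ?_
    rintro _ ⟨S, hS, hdom, rfl⟩
    refine ⟨_, ⟨(fun s n => sSup (s n) + 1) '' S, ?_, rfl⟩, mk_image_le⟩
    rintro ⟨y, hy⟩
    obtain ⟨s, hs, hsy⟩ := hdom y
    have hle := hy _ ⟨s, hs, rfl⟩
    refine hsy (hJ.subset_mem hle fun n hn => ?_)
    have := le_csSup (hS s hs n).bddAbove hn
    simp only [Set.mem_compl_iff, Set.mem_ofPred_eq]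
    omega

theorem slt_finIdeal_eq_dominatingNumberMod {J : Set (Set ℕ)} (hJ : IsIdealOn J) :
    slt (valuedIn FinIdeal) J = dominatingNumberMod J := by
  apply le_antisymm
  · refine minCard_le_minCard ?_
    rintro _ ⟨D, hD, rfl⟩
    refine ⟨_, ⟨(fun x n => Set.Iic (x n)) '' D, ?_, fun y => ?_, rfl⟩, mk_image_le⟩
    · rintro _ ⟨x, -, rfl⟩ n
      exact Set.finite_Iic _
    · obtain ⟨z, hz, hyz⟩ := hD y
      exact ⟨_, ⟨z, hz, rfl⟩, hyz⟩
  · refine minCard_le_minCard ?_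
    rintro _ ⟨S, hS, hdom, rfl⟩
    refine ⟨_, ⟨(fun s n => sSup (s n)) '' S, fun y => ?_, rfl⟩, mk_image_le⟩
    obtain ⟨s, hs, hsy⟩ := hdom y
    refine ⟨_, ⟨s, hs, rfl⟩, hJ.subset_mem hsy fun n hn hmem => hn ?_⟩
    exact le_csSup (hS s hs n).bddAbove hmem


/-! ### Infinitely often equal families -/

/-- Every `x : ι → ℕ` agrees with a member of `F` infinitely often. -/
def IsInfinitelyEqual {ι α : Type*} (F : Set (ι → α)) : Prop :=
  ∀ x : ι → α, ∃ f ∈ F, {i | f i = x i}.Infinite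

theorem IsInfinitelyEqual.image_equiv {ι κ α β : Type*} {F : Set (ι → α)}
    (hF : IsInfinitelyEqual F) (e : κ ≃ ι) (p : α ≃ β) :
    IsInfinitelyEqual ((fun f k => p (f (e k))) '' F) := by
  intro x
  obtain ⟨f, hf, hx⟩ := hF fun i => p.symm (x (e.symm i))
  refine ⟨_, ⟨f, hf, rfl⟩, ?_⟩
  have : {k | p (f (e k)) = x k} = e ⁻¹' {i | f i = p.symm (x (e.symm i))} := by
    ext k
    simp [Equiv.eq_symm_apply]
  rw [this]
  exact hx.preimage (by simp)

/-- An infinitely often equal family yields one whose members even agree infinitely often on a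
prescribed infinite set. -/
theorem IsInfinitelyEqual.exists_on_infinite {α : Type} [Countable α] [Infinite α]
    {F : Set (ℕ → ℕ)} (hF : IsInfinitelyEqual F) :
    ∃ F' : Set (ℕ → α), #F' ≤ #F ∧ ∀ (A : Set ℕ), A.Infinite → ∀ x : ℕ → α,
      ∃ f ∈ F', {n | n ∈ A ∧ f n = x n}.Infinite := by
  classical
  -- At stage `n` a function guesses `n + 1` values of `x` at distinct places of `A`. Only `n`
  -- entries have been recorded before, so a correct guess contains a fresh place, and its value is
  -- recorded there. Different correct stages thus give different places of agreement.
  obtain ⟨c⟩ : Nonempty (ℕ ≃ List (ℕ × α)) := nonempty_equiv_of_countable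
  have a₀ : α := Classical.arbitrary α
  -- a new position from the guess `l`, avoiding `used`
  let pick : List (ℕ × α) → List (ℕ × α) → ℕ × α := fun used l =>
    (l.find? fun p => p.1 ∉ used.map Prod.fst).getD (0, a₀)
  let st : (ℕ → ℕ) → ℕ → List (ℕ × α) := fun f =>
    Nat.rec (motive := fun _ => List (ℕ × α)) []
      (fun n used => used ++ [pick used (c (f n))])
  have hlen : ∀ f n, (st f n).length = n := by
    intro f n
    induction n with
    | zero => rfl
    | succ n ih => simp [st] at ih ⊢; exact ih
  have hpre : ∀ f m n, m ≤ n → st f m <+: st f n := by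
    intro f m n hmn
    induction n, hmn using Nat.le_induction with
    | base => exact List.prefix_rfl
    | succ n _ ih => exact ih.trans ⟨_, rfl⟩
  -- the first guess made for the position `i`
  let val : (ℕ → ℕ) → ℕ → α := fun f i =>
    if h : ∃ n, i ∈ (st f n).map Prod.fst then
      (((st f (Nat.find h)).find? fun p => p.1 = i).getD (0, a₀)).2 else a₀
  have hval : ∀ f n i a, i ∉ (st f n).map Prod.fst → pick (st f n) (c (f n)) = (i, a) →
      val f i = a := by
    intro f n i a hi hp
    have hst : st f (n + 1) = st f n ++ [(i, a)] := by rw [← hp]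
    have h : ∃ n, i ∈ (st f n).map Prod.fst := ⟨n + 1, by rw [hst]; simp⟩
    have hfind : Nat.find h = n + 1 := by
      rw [Nat.find_eq_iff]
      refine ⟨by rw [hst]; simp, fun m hm hmem => hi ?_⟩
      exact ((hpre f m n (by omega)).map _).subset hmem
    have hnone : (st f n).find? (fun p => p.1 = i) = none := by
      rw [List.find?_eq_none]
      intro p hp' hpi
      exact hi (List.mem_map.2 ⟨p, hp', by simpa using hpi⟩)
    simp only [val, dif_pos h, hfind, hst, List.find?_append, hnone]
    simp
  refine ⟨val '' F, mk_image_le, fun A hA x => ?_⟩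
  have hg : ∀ n : ℕ, ∃ l : List (ℕ × α), (l.map Prod.fst).Nodup ∧ l.length = n + 1 ∧
      ∀ p ∈ l, p.1 ∈ A ∧ p.2 = x p.1 := by
    intro n
    obtain ⟨t, htA, ht⟩ := hA.exists_subset_card_eq (n + 1)
    refine ⟨t.toList.map fun i => (i, x i), ?_, by simp [ht], ?_⟩
    · simpa [Function.comp_def] using t.nodup_toList
    · intro p hp
      obtain ⟨i, hi, rfl⟩ := List.mem_map.1 hp
      exact ⟨htA (by simpa using hi), rfl⟩
  choose g hnd hgl hgA using hg
  obtain ⟨f, hf, hinf⟩ := hF fun n => c.symm (g n)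
  refine ⟨_, ⟨f, hf, rfl⟩, ?_⟩
  have hgood : ∀ n, f n = c.symm (g n) → ∃ i, pick (st f n) (c (f n)) = (i, x i) ∧ i ∈ A ∧
      i ∉ (st f n).map Prod.fst := by
    intro n hn
    have hex : ∃ p ∈ g n, p.1 ∉ (st f n).map Prod.fst := by
      by_contra! hcon
      have hsub : (g n).map Prod.fst ⊆ (st f n).map Prod.fst := by
        intro i hi
        obtain ⟨p, hp, rfl⟩ := List.mem_map.1 hi
        exact hcon p hp
      have := ((hnd n).subperm hsub).length_le
      simp [hgl, hlen] at this
    have hsome : ((g n).find? fun p => p.1 ∉ (st f n).map Prod.fst).isSome := by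
      rw [List.find?_isSome]
      obtain ⟨p, hp, hp'⟩ := hex
      exact ⟨p, hp, by simpa using hp'⟩
    obtain ⟨p, hp⟩ := Option.isSome_iff_exists.1 hsome
    have hmem := List.mem_of_find?_eq_some hp
    have hnot := List.find?_some hp
    have hpick : pick (st f n) (c (f n)) = p := by
      simp only [pick, hn, Equiv.apply_symm_apply]
      rw [hp]; rfl
    refine ⟨p.1, ?_, (hgA n p hmem).1, by simpa using hnot⟩
    rw [hpick, ← (hgA n p hmem).2]
  choose! i hi1 hi2 hi3 using hgood
  have hinj : Set.InjOn i {n | f n = c.symm (g n)} := by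
    have key : ∀ m n, m < n → f m = c.symm (g m) → f n = c.symm (g n) → i m ≠ i n := by
      intro m n hmn hm hn heq
      apply hi3 n hn
      rw [← heq]
      refine ((hpre f (m + 1) n hmn).map _).subset ?_
      have : st f (m + 1) = st f m ++ [(i m, x (i m))] := by rw [← hi1 m hm]
      rw [this]; simp
    intro m hm n hn heq
    rcases lt_trichotomy m n with h | h | h
    · exact (key m n h hm hn heq).elim
    · exact h
    · exact (key n m h hn hm heq.symm).elim
  refine (hinf.image hinj).mono ?_
  rintro _ ⟨n, hn, rfl⟩
  exact ⟨hi2 n hn, hval f n _ _ (hi3 n hn) (hi1 n hn)⟩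

theorem IsInfinitelyEqual.infinite {F : Set (ℕ → ℕ)} (hF : IsInfinitelyEqual F) : F.Infinite := by
  intro hfin
  obtain ⟨f, hf, hx⟩ := hF fun n => ∑ f ∈ hfin.toFinset, f n + 1
  obtain ⟨n, hn⟩ := hx.nonempty
  have : f n ≤ ∑ f ∈ hfin.toFinset, f n :=
    Finset.single_le_sum (f := fun f : ℕ → ℕ => f n) (fun _ _ => Nat.zero_le _) (by simpa using hf)
  simp only [Set.mem_ofPred_eq] at hn
  omega

/-- Every infinitely often equal family of functions contains, for countably many functions `y i`,
a member exceeding each of them infinitely often. -/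
theorem IsInfinitelyEqual.exists_unbounded {ι : Type*} [Countable ι] {F : Set (ℕ → ℕ)}
    (hF : IsInfinitelyEqual F) (y : ι → ℕ → ℕ) :
    ∃ f ∈ F, ∀ i, {n | y i n ≤ f n}.Infinite := by
  rcases isEmpty_or_nonempty ι with _ | _
  · obtain ⟨f, hf, -⟩ := hF 0
    exact ⟨f, hf, fun i => isEmptyElim i⟩
  obtain ⟨e, he⟩ := exists_surjective_nat ι
  obtain ⟨f, hf, hx⟩ := hF fun n => ∑ j ∈ Finset.range (n + 1), y (e j) n
  refine ⟨f, hf, fun i => ?_⟩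
  obtain ⟨j, rfl⟩ := he i
  refine (hx.sdiff (Set.finite_Iio j)).mono ?_
  rintro n ⟨hn, hj⟩
  simp only [Set.mem_ofPred_eq, Set.mem_Iio, not_lt] at hn hj ⊢
  rw [hn]
  exact Finset.single_le_sum (f := fun j => y (e j) n) (fun _ _ => Nat.zero_le _)
    (Finset.mem_range.2 (by omega))

/-! ### Functions meeting every strategy. -/

/-- The restriction of `z` to `n`, as a list. -/
def initialSegment (z : ℕ → ℕ) (n : ℕ) : List ℕ := (List.range n).map z

theorem initialSegment_succ (z : ℕ → ℕ) (n : ℕ) :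
    initialSegment z (n + 1) = initialSegment z n ++ [z n] := by
  simp [initialSegment, List.range_succ]

/-- The set of lists of length `n` bounded by `q`. -/
def boundedLists (q : ℕ → ℕ) : ℕ → Finset (List ℕ)
  | 0 => {[]}
  | n + 1 => (boundedLists q n ×ˢ Finset.range (q n + 1)).image fun p => p.1 ++ [p.2]

theorem initialSegment_mem_boundedLists {z q : ℕ → ℕ} (h : ∀ n, z n ≤ q n) (n : ℕ) :
    initialSegment z n ∈ boundedLists q n := by
  induction n with
  | zero => simp [initialSegment, boundedLists]
  | succ n ih =>
    rw [initialSegment_succ, boundedLists, Finset.mem_image]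
    exact ⟨(_, _), Finset.mem_product.2 ⟨ih, Finset.mem_range.2 (Nat.lt_succ_of_le (h n))⟩, rfl⟩

theorem boundedLists_mono {q r : ℕ → ℕ} {n : ℕ} (h : ∀ i < n, q i ≤ r i) :
    boundedLists q n ⊆ boundedLists r n := by
  induction n with
  | zero => simp [boundedLists]
  | succ n ih =>
    refine Finset.image_subset_image (Finset.product_subset_product
      (ih fun i hi => h i (by omega)) ?_)
    exact Finset.range_subset_range.2 (Nat.succ_le_succ (h n (by omega)))

/-- The function extending `t` with least values bounding the strategy `i` on bounded lists. -/
theorem exists_bounding_extension (i : List ℕ → ℕ) (t : List ℕ) :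
    ∃ y : ℕ → ℕ, (∀ n < t.length, t.getD n 0 ≤ y n) ∧
      ∀ n, ∀ τ ∈ boundedLists y n, i τ ≤ y n := by
  let st : ℕ → Finset (List ℕ) × ℕ := Nat.rec (motive := fun _ => Finset (List ℕ) × ℕ)
    ({[]}, i [] + t.getD 0 0)
    (fun n p =>
      let R := (p.1 ×ˢ Finset.range (p.2 + 1)).image fun r => r.1 ++ [r.2]
      (R, (R.sup i) + t.getD (n + 1) 0))
  have h1 : ∀ n, (st n).1 = boundedLists (fun n => (st n).2) n := by
    intro n
    induction n with
    | zero => rfl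
    | succ n ih => rw [boundedLists, ← ih]
  have h2 : ∀ n, (st n).2 = (st n).1.sup i + t.getD n 0 := by
    rintro (_ | n)
    · simp [st]
    · rfl
  refine ⟨fun n => (st n).2, fun n _ => ?_, fun n τ hτ => ?_⟩
  · simp only [h2 n]; omega
  · rw [← h1] at hτ
    have := Finset.le_sup (f := i) hτ
    simp only [h2 n]; omega

/-- An infinitely often equal family yields a family, of at most the same size, meeting every
strategy infinitely often. -/
theorem IsInfinitelyEqual.exists_strategy {F : Set (ℕ → ℕ)} (hF : IsInfinitelyEqual F) :
    ∃ Z : Set (ℕ → ℕ), #Z ≤ #F ∧ ∀ i : List ℕ → ℕ,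
      ∃ z ∈ Z, {n | z n = i (initialSegment z n)}.Infinite := by
  classical
  obtain ⟨F', hF', hF'A⟩ := hF.exists_on_infinite (α := List ℕ →₀ ℕ)
  let st : (ℕ → ℕ) → (ℕ → (List ℕ →₀ ℕ)) → ℕ → List ℕ := fun q f =>
    Nat.rec (motive := fun _ => List ℕ) [] (fun n τ => τ ++ [min (q n) (f n τ)])
  -- `f n` guesses the strategy on a finite set of histories, and `q` caps the moves so that only
  -- finitely many histories of each length are possible.
  let zz : (ℕ → ℕ) → (ℕ → (List ℕ →₀ ℕ)) → ℕ → ℕ := fun q f n => min (q n) (f n (st q f n))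
  have hst : ∀ q f n, st q f n = initialSegment (zz q f) n := by
    intro q f n
    induction n with
    | zero => rfl
    | succ n ih => rw [initialSegment_succ, ← ih]
  refine ⟨Set.range fun p : F × F' => zz p.1.1 p.2.1, ?_, fun i => ?_⟩
  · refine mk_range_le.trans ?_
    rw [mk_prod, lift_id, lift_id]
    exact (mul_le_mul_right hF' _).trans
      (mul_eq_self (infinite_iff.1 hF.infinite.to_subtype)).le
  choose y hy1 hy2 using exists_bounding_extension i
  obtain ⟨q, hq, hqy⟩ := hF.exists_unbounded fun t n => y t n + 1
  -- The cap must not cut off the strategy infinitely often. Otherwise `q` would, from some point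
  -- on, lie below the bound `y t` grown from its own initial segment `t`, against the choice of
  -- `q`.
  have hA : {n | ∀ τ ∈ boundedLists q n, i τ ≤ q n}.Infinite := by
    intro hfin
    obtain ⟨N, hN⟩ := hfin.bddAbove
    have hlt : ∀ n, N < n → ∃ τ ∈ boundedLists q n, q n < i τ := by
      intro n hn
      by_contra! hcon
      exact absurd (hN hcon) (not_le.2 hn)
    let t := initialSegment q (N + 1)
    have hle : ∀ n, q n ≤ y t n := by
      intro n
      induction n using Nat.strong_induction_on with
      | _ n ih =>
        rcases lt_or_ge n (N + 1) with hn | hn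
        · have := hy1 t n (by simpa [t, initialSegment] using hn)
          simpa [t, initialSegment, List.getD, hn] using this
        · obtain ⟨τ, hτ, hlt⟩ := hlt n hn
          exact hlt.le.trans (hy2 t n τ (boundedLists_mono ih hτ))
    obtain ⟨n, hn⟩ := (hqy t).nonempty
    have := hle n
    simp only [Set.mem_ofPred_eq] at hn
    omega
  obtain ⟨f, hf, hinf⟩ := hF'A _ hA fun n =>
    Finsupp.onFinset ((boundedLists q n)) (fun τ => if τ ∈ boundedLists q n then i τ else 0)
      (fun τ h => by by_contra hc; simp [hc] at h)
  refine ⟨_, ⟨(⟨q, hq⟩, ⟨f, hf⟩), rfl⟩, hinf.mono ?_⟩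
  rintro n ⟨hn, hfn⟩
  have hmem := initialSegment_mem_boundedLists (z := zz q f) (q := q)
    (fun n => min_le_left _ _) n
  simp only [Set.mem_ofPred_eq] at hn ⊢
  have : zz q f n = min (q n) (f n (st q f n)) := rfl
  rw [this, hst, hfn, Finsupp.onFinset_apply, if_pos hmem, min_eq_right (hn _ hmem)]

/-- A family of slaloms guessing every function infinitely often yields an infinitely often equal
family. -/
theorem exists_isInfinitelyEqual_of_slaloms {h : ℕ → ℕ} {S : Set (ℕ → Set ℕ)}
    (hS : ∀ s ∈ S, ∀ n, (s n).encard ≤ h n)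
    (hdom : ∀ x : ℕ → ℕ, ∃ s ∈ S, {n | x n ∈ s n}.Infinite) :
    ∃ F : Set (ℕ → ℕ), #F ≤ #S ∧ IsInfinitelyEqual F := by
  classical
  obtain ⟨c⟩ : Nonempty (ℕ ≃ (ℕ →₀ ℕ)) := nonempty_equiv_of_countable
  have hfin : ∀ s ∈ S, ∀ n, ∃ w : ℕ → ℕ, ∀ a ∈ s n, ∃ j < h n, w j = a := by
    intro s hs n
    have hfin : (s n).Finite := Set.finite_of_encard_le_coe (hS s hs n)
    have hcard : hfin.toFinset.card ≤ h n := by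
      have := hS s hs n
      rw [hfin.encard_eq_coe_toFinset_card] at this
      exact_mod_cast this
    refine ⟨fun j => hfin.toFinset.toList.getD j 0, fun a ha => ?_⟩
    have : a ∈ hfin.toFinset.toList := by simpa using ha
    obtain ⟨j, hj, rfl⟩ := List.getElem_of_mem this
    exact ⟨j, lt_of_lt_of_le (by simpa using hj) hcard, List.getD_eq_getElem _ _ hj⟩
  choose! w hw using hfin
  -- The slalom guesses the whole block `x (n, 0), …, x (n, h n - 1)`. If the guess with number `j`
  -- is right, its `j`-th coordinate is right, so reading the diagonal gives a single value at `(n,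
  -- j)`.
  have hequal : IsInfinitelyEqual ((fun s (p : ℕ × ℕ) => c (w s p.1 p.2) p.2) '' S) := by
    intro x
    obtain ⟨s, hs, hinf⟩ := hdom fun n => c.symm <| Finsupp.onFinset (Finset.range (h n))
      (fun j => if j < h n then x (n, j) else 0) fun j hj => by
        by_contra hc; simp at hc; simp [not_lt.2 hc] at hj
    refine ⟨_, ⟨s, hs, rfl⟩, Set.Infinite.of_image Prod.fst (hinf.mono fun n hn => ?_)⟩
    obtain ⟨j, hj, hwj⟩ := hw s hs n _ hn
    refine ⟨(n, j), ?_, rfl⟩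
    simp [hwj, hj]
  exact ⟨_, mk_image_le.trans mk_image_le,
    hequal.image_equiv Nat.pairEquiv.symm (Equiv.refl ℕ)⟩


/-! ### The uniformity of the meager ideal -/

/-- Reals can be coded by functions such that every function agrees infinitely often with the
codes of comeagerly many reals. -/
theorem exists_comeager_coding :
    ∃ φ : ℝ → ℕ → ℕ, ∀ x : ℕ → ℕ, IsMeagre {r | ∃ᶠ n in atTop, φ r n = x n}ᶜ := by
  obtain ⟨e, he⟩ := exists_surjective_nat (ℚ × ℚ)
  let a : ℕ → ℝ := fun n => (e n.unpair.1).1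
  let b : ℕ → ℝ := fun n => (e n.unpair.1).2
  -- For `r` inside `(a n, b n)`, this numbers consecutive subintervals accumulating at `b n`, so
  -- every value is taken on some open piece of the interval.
  let φ : ℝ → ℕ → ℕ := fun r n => ⌊(b n - a n) / (b n - r)⌋₊ - 1
  refine ⟨φ, fun x => ?_⟩
  let W : ℕ → Set ℝ := fun N => ⋃ n ≥ N, interior {r | φ r n = x n}
  have hopen : ∀ N, IsOpen (W N) := fun N =>
    isOpen_biUnion fun n _ => isOpen_interior
  have hdense : ∀ N, Dense (W N) := by
    intro N
    rw [dense_iff_inter_open]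
    rintro U hU ⟨r, hr⟩
    obtain ⟨l, u, hlu, hsub⟩ := mem_nhds_iff_exists_Ioo_subset.1 (hU.mem_nhds hr)
    obtain ⟨p, hp1, hp2⟩ := exists_rat_btwn hlu.1
    obtain ⟨q, hq1, hq2⟩ := exists_rat_btwn hlu.2
    obtain ⟨k, hk⟩ := he (p, q)
    -- Pairing with `N` repeats every rational interval at indices beyond any bound.
    let n := Nat.pair k N
    have ha : a n = p := by simp [a, n, hk]
    have hb : b n = q := by simp [b, n, hk]
    have hpq : (p : ℝ) < q := hp2.trans hq1
    have hd : (0 : ℝ) < q - p := sub_pos.2 hpq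
    have hm : (0 : ℝ) < x n + 1 := by positivity
    have hm2 : (0 : ℝ) < x n + 2 := by positivity
    have hJ : Set.Ioo ((q : ℝ) - (q - p) / (x n + 1)) (q - (q - p) / (x n + 2)) ⊆
        {r | φ r n = x n} := by
      rintro r ⟨h1, h2⟩
      have hr : (0 : ℝ) < q - r := by
        have : 0 < ((q : ℝ) - p) / (x n + 2) := by positivity
        linarith
      have e1 : (q : ℝ) - r < (q - p) / (x n + 1) := by linarith
      have e2 : ((q : ℝ) - p) / (x n + 2) < q - r := by linarith
      rw [lt_div_iff₀ hm] at e1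
      rw [div_lt_iff₀ hm2] at e2
      have : ⌊((q : ℝ) - p) / (q - r)⌋₊ = x n + 1 := by
        rw [Nat.floor_eq_iff (by positivity)]
        push_cast
        constructor
        · rw [le_div_iff₀ hr]; linarith
        · rw [div_lt_iff₀ hr]; linarith
      simp only [Set.mem_ofPred_eq, φ, ha, hb, this]
      omega
    have hlt : (q : ℝ) - (q - p) / (x n + 1) < q - (q - p) / (x n + 2) := by
      have : ((q : ℝ) - p) / (x n + 2) < (q - p) / (x n + 1) :=
        div_lt_div_of_pos_left hd hm (by linarith)
      linarith
    obtain ⟨s, hs1, hs2⟩ := exists_between hlt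
    refine ⟨s, hsub ⟨?_, ?_⟩, ?_⟩
    · have : ((q : ℝ) - p) / (x n + 1) ≤ q - p := div_le_self hd.le (by simp)
      linarith
    · have : 0 < ((q : ℝ) - p) / (x n + 2) := by positivity
      linarith
    · refine Set.mem_biUnion (show n ≥ N from Nat.right_le_pair k N) ?_
      exact interior_maximal hJ isOpen_Ioo ⟨hs1, hs2⟩
  rw [IsMeagre, compl_compl]
  refine mem_of_superset (countable_iInter_mem.2 fun N =>
    residual_of_dense_open (hopen N) (hdense N)) ?_
  intro r hr
  rw [Set.mem_iInter] at hr
  refine frequently_atTop.2 fun N => ?_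
  obtain ⟨n, hn, hrn⟩ := Set.mem_iUnion₂.1 (hr N)
  exact ⟨n, hn, (interior_subset hrn : r ∈ {r | φ r n = x n})⟩

/-- A non-meager set contains a real whose code meets a given `x` infinitely often; the codes, as
singletons, are the slaloms, with the empty set where `h n = 0`. -/
theorem sle_boundedBy_le_nonMeager {h : ℕ → ℕ} (hh : ∀ᶠ n in atTop, 1 ≤ h n) :
    sle (boundedBy (fun _ => ℕ) h) FinIdeal ≤ nonMeager := by
  obtain ⟨φ, hφ⟩ := exists_comeager_coding
  refine minCard_le_minCard ?_
  rintro _ ⟨F, hF, rfl⟩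
  refine ⟨_, ⟨(fun r n => {m | 1 ≤ h n ∧ m = φ r n}) '' F, ?_, fun x => ?_, rfl⟩, mk_image_le⟩
  · rintro _ ⟨r, -, rfl⟩ n
    by_cases hn : 1 ≤ h n
    · simp [hn]
    · simp [hn]
  · by_contra! hcon
    refine hF ⟨⟨_, hφ x⟩, fun r hr hfreq => hcon _ ⟨r, hr, rfl⟩ ?_⟩
    rw [mem_compl_finIdeal]
    exact (hfreq.and_eventually hh).mono fun n hn => ⟨hn.2, hn.1.symm⟩

/-- Strategies lift to dense open sets: there is a map from functions to reals such that the image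
of every family meeting all strategies is non-meager. -/
theorem exists_nonmeager_of_strategy :
    ∃ ψ : (ℕ → ℕ) → ℝ, ∀ M : Set ℝ, IsMeagre M → ∃ i : List ℕ → ℕ, ∀ z : ℕ → ℕ,
      {n | z n = i (initialSegment z n)}.Infinite → ψ z ∉ M := by
  classical
  let Q := {p : ℚ × ℚ // p.1 < p.2}
  have : Nonempty Q := ⟨⟨(0, 1), by norm_num⟩⟩
  obtain ⟨e, he⟩ := exists_surjective_nat Q
  let C : Q → Set ℝ := fun p => Set.Icc (p.1.1 : ℝ) p.1.2
  let O : Q → Set ℝ := fun p => Set.Ioo (p.1.1 : ℝ) p.1.2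
  -- A function lists moves in a game of nested intervals; an illegal move leaves the interval
  -- unchanged.
  let step : Q → ℕ → Q := fun p m => if C (e m) ⊆ C p then e m else p
  have hstep : ∀ p m, C (step p m) ⊆ C p := by
    intro p m
    by_cases hc : C (e m) ⊆ C p
    · simp [step, hc]
    · simp [step, hc]
  let U : List ℕ → Q := fun τ => τ.foldl step (e 0)
  have hU : ∀ z n, U (initialSegment z (n + 1)) = step (U (initialSegment z n)) (z n) := by
    intro z n
    simp [U, initialSegment_succ]
  have hne : ∀ z : ℕ → ℕ, (⋂ n, C (U (initialSegment z n))).Nonempty := by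
    intro z
    refine IsCompact.nonempty_iInter_of_sequence_nonempty_isCompact_isClosed _ ?_ ?_ ?_ ?_
    · intro n
      rw [hU]
      exact hstep _ _
    · intro n
      exact Set.nonempty_Icc.2 (by exact_mod_cast (U (initialSegment z n)).2.le)
    · exact isCompact_Icc
    · exact fun n => isClosed_Icc
  choose ψ hψ using hne
  refine ⟨ψ, fun M hM => ?_⟩
  obtain ⟨S, hSo, hSd, hSc, hSM⟩ := mem_residual_iff.1 hM
  have hSc' : (insert Set.univ S).Countable := hSc.insert _
  -- Adding `Set.univ` makes the family nonempty, so that a sequence enumerates it.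
  obtain ⟨E, hE⟩ := hSc'.exists_eq_range (Set.insert_nonempty _ _)
  have hEo : ∀ n, IsOpen (E n) ∧ Dense (E n) := by
    intro n
    have : E n ∈ insert Set.univ S := hE ▸ ⟨n, rfl⟩
    rcases this with h | h
    · rw [h]; exact ⟨isOpen_univ, dense_univ⟩
    · exact ⟨hSo _ h, hSd _ h⟩
  let D : ℕ → Set ℝ := fun n => ⋂ k ∈ Set.Iic n, E k
  have hDo : ∀ n, IsOpen (D n) := fun n => (Set.finite_Iic n).isOpen_biInter fun k _ => (hEo k).1
  have hDd : ∀ n, Dense (D n) := fun n =>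
    dense_biInter_of_isOpen (fun k _ => (hEo k).1) (Set.to_countable _) fun k _ => (hEo k).2
  have hi : ∀ τ : List ℕ, ∃ m, C (e m) ⊆ C (U τ) ∧ C (e m) ⊆ D τ.length := by
    intro τ
    have hnon : (O (U τ)).Nonempty := Set.nonempty_Ioo.2 (by exact_mod_cast (U τ).2)
    obtain ⟨r, hrO, hrD⟩ := (hDd τ.length).inter_open_nonempty _ isOpen_Ioo hnon
    obtain ⟨l, u, hlu, hsub⟩ := mem_nhds_iff_exists_Ioo_subset.1
      ((isOpen_Ioo.inter (hDo τ.length)).mem_nhds ⟨hrO, hrD⟩)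
    obtain ⟨p, hp1, hp2⟩ := exists_rat_btwn hlu.1
    obtain ⟨q, hq1, hq2⟩ := exists_rat_btwn hlu.2
    have hpq : p < q := by exact_mod_cast hp2.trans hq1
    obtain ⟨m, hm⟩ := he ⟨(p, q), hpq⟩
    have hC : C (e m) ⊆ Set.Ioo l u := by
      rw [hm]
      exact fun y hy => ⟨hp1.trans_le hy.1, hy.2.trans_lt hq2⟩
    exact ⟨m, fun y hy => Set.Ioo_subset_Icc_self (hsub (hC hy)).1, fun y hy => (hsub (hC hy)).2⟩
  -- The strategy moves into `D n` at step `n`. These sets decrease, so obeying it infinitely often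
  -- puts `ψ z` into every `E k`.
  choose i hi1 hi2 using hi
  refine ⟨i, fun z hz hM => ?_⟩
  have hz' : ψ z ∈ ⋂₀ S := by
    intro s hs
    have hsr : s ∈ Set.range E := hE ▸ Set.mem_insert_of_mem _ hs
    obtain ⟨k, rfl⟩ := hsr
    obtain ⟨n, hn, hkn⟩ := hz.exists_gt k
    have h1 := Set.mem_iInter.1 (hψ z) (n + 1)
    simp only [Set.mem_ofPred_eq] at hn
    rw [hU, hn] at h1
    simp only [step, hi1, if_true] at h1
    have h2 := hi2 _ h1
    have hlen : (initialSegment z n).length = n := by simp [initialSegment]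
    rw [hlen] at h2
    exact Set.mem_iInter₂.1 h2 k hkn.le
  exact hSM hz' hM

theorem nonMeager_le_sle_boundedBy (h : ℕ → ℕ) :
    nonMeager ≤ sle (boundedBy (fun _ => ℕ) h) FinIdeal := by
  refine minCard_le_minCard ?_
  rintro _ ⟨S, hS, hdom, rfl⟩
  obtain ⟨F, hFS, hF⟩ := exists_isInfinitelyEqual_of_slaloms hS hdom
  obtain ⟨Z, hZF, hZ⟩ := hF.exists_strategy
  obtain ⟨ψ, hψ⟩ := exists_nonmeager_of_strategy
  refine ⟨_, ⟨ψ '' Z, ?_, rfl⟩, mk_image_le.trans (hZF.trans hFS)⟩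
  rintro ⟨⟨M, hM⟩, hsub⟩
  obtain ⟨i, hi⟩ := hψ M hM
  obtain ⟨z, hz, hinf⟩ := hZ i
  exact hi z hinf (hsub _ ⟨z, hz, rfl⟩)

theorem nonS1_boundedBy_eq_nonMeager {h : ℕ → ℕ} (hh : ∀ᶠ n in atTop, 1 ≤ h n) :
    nonS1 (GammaH h) FinIdeal = nonMeager :=
  (nonS1_eq_sle _ _).trans
    ((sle_boundedBy_le_nonMeager hh).antisymm (nonMeager_le_sle_boundedBy h))


/-! ### The cofinality of the null ideal -/

theorem exists_nat_basis :
    ∃ B : ℕ → Set ℝ, TopologicalSpace.IsTopologicalBasis (Set.range B) := by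
  have hbasis := TopologicalSpace.isBasis_countableBasis ℝ
  obtain ⟨V, hV, -⟩ := hbasis.exists_subset_of_mem_open (Set.mem_univ (0 : ℝ)) isOpen_univ
  obtain ⟨B, hB⟩ := (TopologicalSpace.countable_countableBasis ℝ).exists_eq_range ⟨V, hV⟩
  exact ⟨B, hB ▸ hbasis⟩

/-- Null sets of reals are coded by functions: there are countably many measurable sets such that
every null set is contained in the limit superior of a sequence of them, with measures as small as
prescribed. -/
theorem exists_null_coding :
    ∃ C : ℕ → Set ℝ, ∀ ε : ℕ → ENNReal, (∀ n, ε n ≠ 0) → ∀ A : Set ℝ, volume A = 0 →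
      ∃ x : ℕ → ℕ, (∀ n, volume (C (x n)) ≤ ε n) ∧ ∀ a ∈ A, ∃ᶠ n in atTop, a ∈ C (x n) := by
  classical
  obtain ⟨B, hbasis⟩ := exists_nat_basis
  obtain ⟨e, he⟩ := exists_surjective_nat (Finset ℕ × Finset ℕ)
  let W : Finset ℕ → Set ℝ := fun F => ⋃ i ∈ F, B i
  have hBo : ∀ i, IsOpen (B i) := fun i => hbasis.isOpen ⟨i, rfl⟩
  have hWo : ∀ F, IsOpen (W F) := fun F => isOpen_biUnion fun i _ => hBo i
  refine ⟨fun m => W (e m).1 \ W (e m).2, fun ε hε A hA => ?_⟩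
  have hU : ∀ k, ∃ U, A ⊆ U ∧ IsOpen U ∧ volume U < ε (Nat.pair k 0) := fun k =>
    A.exists_isOpen_lt_of_lt _ (by rw [hA]; exact pos_iff_ne_zero.2 (hε _))
  choose U hAU hUo hUε using hU
  let F : ℕ → ℕ → Finset ℕ := fun k N => (Finset.range N).filter fun i => B i ⊆ U k
  have hFmono : ∀ k, Monotone fun N => W (F k N) := by
    intro k N N' hN
    refine Set.biUnion_mono ?_ fun _ _ => le_rfl
    intro i hi
    simp only [F, Finset.coe_filter, Finset.mem_range, Set.mem_ofPred_eq] at hi ⊢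
    exact ⟨hi.1.trans_le hN, hi.2⟩
  have hFU : ∀ k N, W (F k N) ⊆ U k := by
    intro k N
    refine Set.iUnion₂_subset fun i hi => ?_
    exact (Finset.mem_filter.1 hi).2
  have hcov : ∀ k, ⋃ N, W (F k N) = U k := by
    intro k
    refine (Set.iUnion_subset (hFU k)).antisymm fun a ha => ?_
    obtain ⟨V, hV, haV, hVU⟩ := hbasis.exists_subset_of_mem_open ha (hUo k)
    obtain ⟨i, rfl⟩ := hV
    refine Set.mem_iUnion.2 ⟨i + 1, Set.mem_biUnion (x := i) ?_ haV⟩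
    simp [F, hVU]
  have htend : ∀ k, Tendsto (fun N => volume (U k \ W (F k N))) atTop (nhds 0) := by
    intro k
    have hempty : ⋂ N, U k \ W (F k N) = ∅ := by
      rw [← Set.sdiff_iUnion, hcov, Set.sdiff_self]
    rw [← measure_empty (μ := (volume : Measure ℝ)), ← hempty]
    refine tendsto_measure_iInter_atTop
      (fun N => ((hUo k).measurableSet.diff (hWo _).measurableSet).nullMeasurableSet) ?_ ?_
    · exact fun N N' hN => Set.sdiff_subset_sdiff_right (hFmono k hN)
    · exact ⟨0, ((measure_mono Set.sdiff_subset).trans_lt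
        ((hUε k).trans_le le_top)).ne⟩
  -- The differences of successive finite unions cover `U k`, the piece numbered `j` lying in the
  -- part of `U k` left over after stage `M k j`. Starting from `M = 0`, the empty union, loses no
  -- point of `U k`.
  have hM : ∀ k j, ∃ M, j ≤ M ∧ (j = 0 → M = 0) ∧
      volume (U k \ W (F k M)) ≤ ε (Nat.pair k j) := by
    rintro k (_ | j)
    · exact ⟨0, le_rfl, fun _ => rfl, (measure_mono Set.sdiff_subset).trans (hUε k).le⟩
    · obtain ⟨M, h1, h2⟩ := ((htend k).eventually
        (gt_mem_nhds (pos_iff_ne_zero.2 (hε (Nat.pair k (j + 1))))) |>.and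
          (eventually_ge_atTop (j + 1))).exists
      exact ⟨M, h2, by simp, h1.le⟩
  choose M hM1 hM2 hM3 using hM
  choose d hd using he
  refine ⟨fun n => d (F n.unpair.1 (M n.unpair.1 (n.unpair.2 + 1)),
    F n.unpair.1 (M n.unpair.1 n.unpair.2)), fun n => ?_, fun a ha => ?_⟩
  · simp only [hd]
    refine (measure_mono (Set.sdiff_subset_sdiff_left (hFU _ _))).trans ?_
    simpa using hM3 n.unpair.1 n.unpair.2
  · refine frequently_atTop.2 fun k => ?_
    have hex : ∃ j, a ∈ W (F k (M k j)) := by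
      have : a ∈ ⋃ N, W (F k N) := (hcov k).symm ▸ hAU k ha
      obtain ⟨N, hN⟩ := Set.mem_iUnion.1 this
      exact ⟨N, hFmono k (hM1 k N) hN⟩
    obtain ⟨j, hj⟩ : ∃ j, Nat.find hex = j + 1 := by
      refine Nat.exists_eq_succ_of_ne_zero fun h0 => ?_
      have := Nat.find_spec hex
      rw [h0, hM2 k 0 rfl] at this
      simp [F, W] at this
    refine ⟨Nat.pair k j, Nat.left_le_pair k j, ?_⟩
    simp only [hd, Nat.unpair_pair]
    exact ⟨hj ▸ Nat.find_spec hex, Nat.find_min hex (by omega)⟩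

theorem tsum_half_pow_ne_top (c : ENNReal) (hc : c ≠ ⊤) :
    ∑' n : ℕ, c * (2⁻¹ : ENNReal) ^ n ≠ ⊤ := by
  rw [ENNReal.tsum_mul_left, ENNReal.tsum_geometric, ENNReal.one_sub_inv_two, inv_inv]
  exact ENNReal.mul_ne_top hc (by simp)

/-- A slalom over codes predicts at most `g n` small sets at each `n`; the limit superior of their
unions is null by Borel–Cantelli, and it contains every null set whose code the slalom localizes. -/
theorem cofNull_le_slt_boundedBy (g : ℕ → ℕ) :
    cofNull ≤ slt (boundedBy (fun _ => ℕ) g) FinIdeal := by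
  obtain ⟨C, hC⟩ := exists_null_coding
  refine minCard_le_minCard ?_
  rintro _ ⟨S, hS, hdom, rfl⟩
  -- Then `g n` sets of measure `ε n` have total measure at most `2⁻ⁿ`; the `+ 1` avoids division by
  -- zero.
  let ε : ℕ → ENNReal := fun n => 2⁻¹ ^ n / (g n + 1)
  have hε : ∀ n, ε n ≠ 0 := fun n =>
    (ENNReal.div_pos (pow_ne_zero _ (by simp)) (by finiteness)).ne'
  have hgε : ∀ n, g n * ε n ≤ 1 * 2⁻¹ ^ n := by
    intro n
    calc g n * ε n ≤ (g n + 1) * ε n := by gcongr; exact le_self_add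
      _ = 1 * 2⁻¹ ^ n := by rw [one_mul]; exact ENNReal.mul_div_cancel (by simp) (by finiteness)
  let L : (ℕ → Set ℕ) → ℕ → Set ℝ := fun s n => ⋃ c ∈ {c ∈ s n | volume (C c) ≤ ε n}, C c
  have hL : ∀ s ∈ S, ∀ n, volume (L s n) ≤ 1 * 2⁻¹ ^ n := by
    intro s hs n
    have hfin : {c ∈ s n | volume (C c) ≤ ε n}.Finite :=
      (Set.finite_of_encard_le_coe (hS s hs n)).subset fun _ h => h.1
    have hcard : hfin.toFinset.card ≤ g n := by
      have h1 := (Set.encard_le_encard (fun _ h => h.1 :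
        {c ∈ s n | volume (C c) ≤ ε n} ⊆ s n)).trans (hS s hs n)
      rw [hfin.encard_eq_coe_toFinset_card] at h1
      exact_mod_cast h1
    have hLeq : L s n = ⋃ c ∈ hfin.toFinset, C c := by simp [L]
    rw [hLeq]
    calc volume (⋃ c ∈ hfin.toFinset, C c) ≤ ∑ c ∈ hfin.toFinset, volume (C c) :=
          measure_biUnion_finset_le _ _
      _ ≤ hfin.toFinset.card • ε n :=
          Finset.sum_le_card_nsmul _ _ _ fun c hc => (hfin.mem_toFinset.1 hc).2
      _ ≤ g n * ε n := by rw [nsmul_eq_mul]; gcongr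
      _ ≤ _ := hgε n
  have hnull : ∀ s ∈ S, volume {a | ∃ᶠ n in atTop, a ∈ L s n} = 0 := by
    intro s hs
    refine measure_setOfPred_frequently_eq_zero (p := fun n a => a ∈ L s n) ?_
    exact ne_top_of_le_ne_top (tsum_half_pow_ne_top 1 (by simp))
      (ENNReal.tsum_le_tsum fun n => hL s hs n)
  refine ⟨_, ⟨Set.range fun s : S => (⟨_, hnull s.1 s.2⟩ : {A : Set ℝ // volume A = 0}), ?_, rfl⟩,
    mk_range_le⟩
  rintro ⟨A, hA⟩
  obtain ⟨x, hx1, hx2⟩ := hC ε hε A hA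
  obtain ⟨s, hs, hxs⟩ := hdom x
  rw [mem_dualFamily_finIdeal] at hxs
  refine ⟨_, ⟨⟨s, hs⟩, rfl⟩, fun a ha => ?_⟩
  refine ((hx2 a ha).and_eventually hxs).mono fun n hn => ?_
  exact Set.mem_biUnion (x := x n) ⟨hn.2, hx1 n⟩ hn.1

/-- Sets `G n i` of measure about `2⁻ⁿ` which contain independent events, for every `n`. -/
theorem exists_independent_open :
    ∃ G : ℕ → ℕ → Set ℝ, (∀ n i, IsOpen (G n i)) ∧ (∀ n i, volume (G n i) ≤ 2 * 2⁻¹ ^ n) ∧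
      ∀ n (t : Finset ℕ), volume (Set.Icc 0 1 \ ⋃ i ∈ t, G n i) ≤
        ENNReal.ofReal ((1 - 2⁻¹ ^ n) ^ t.card) := by
  have hp : ∀ n : ℕ, (2⁻¹ : ℝ) ^ n ∈ unitInterval := fun n =>
    ⟨by positivity, pow_le_one₀ (by norm_num) (by norm_num)⟩
  let p : ℕ → unitInterval := fun n => ⟨2⁻¹ ^ n, hp n⟩
  -- Independent uniform variables, transported to Lebesgue measure on the unit interval along `f`.
  let P : Measure (ℕ × ℕ → unitInterval) := Measure.infinitePi fun _ => volume
  obtain ⟨f, hf, hfP⟩ := P.exists_measurable_map_eq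
  have hpre : ∀ T : Set (ℕ × ℕ → unitInterval), MeasurableSet T →
      volume (Subtype.val '' (f ⁻¹' T)) = P T := by
    intro T hT
    rw [← unitInterval.volume_apply, ← Measure.map_apply hf hT, hfP]
  let E : ℕ → ℕ → Set ℝ := fun n i => Subtype.val '' (f ⁻¹' {ω | ω (n, i) ≤ p n})
  have hE : ∀ n i, volume (E n i) = 2⁻¹ ^ n := by
    intro n i
    have := (measurePreserving_eval_infinitePi (fun _ : ℕ × ℕ => (volume : Measure unitInterval))
      (n, i)).measure_preimage (measurableSet_Iic (a := p n)).nullMeasurableSet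
    refine (hpre _ (measurable_pi_apply _ measurableSet_Iic)).trans (this.trans ?_)
    rw [unitInterval.volume_Iic, ENNReal.ofReal_pow (by norm_num),
      ENNReal.ofReal_inv_of_pos (by norm_num), ENNReal.ofReal_ofNat]
  -- Open supersets cost a factor `2` in measure and only shrink the set of points missing them.
  have hG : ∀ n i, ∃ G, E n i ⊆ G ∧ IsOpen G ∧ volume G < 2 * 2⁻¹ ^ n := by
    intro n i
    refine (E n i).exists_isOpen_lt_of_lt _ ?_
    rw [hE, two_mul]
    exact ENNReal.lt_add_right (by finiteness) (pow_ne_zero _ (by simp))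
  choose G hEG hGo hGv using hG
  refine ⟨G, hGo, fun n i => (hGv n i).le, fun n t => ?_⟩
  have hsub : Set.Icc 0 1 \ ⋃ i ∈ t, G n i ⊆ Subtype.val ''
      (f ⁻¹' Set.pi ((t.map ⟨fun i => (n, i), fun _ _ h => (Prod.mk.inj h).2⟩ : Finset (ℕ × ℕ)) :
        Set (ℕ × ℕ)) fun _ => Set.Ioi (p n)) := by
    rintro r ⟨hr, hrG⟩
    refine ⟨⟨r, hr⟩, ?_, rfl⟩
    intro q hq
    obtain ⟨i, hi, rfl⟩ := Finset.mem_map.1 (Finset.mem_coe.1 hq)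
    refine not_le.1 fun hle : f ⟨r, hr⟩ (n, i) ≤ p n => hrG ?_
    exact Set.mem_biUnion (x := i) hi (hEG n i ⟨⟨r, hr⟩, hle, rfl⟩)
  refine (measure_mono hsub).trans ?_
  rw [hpre _ (MeasurableSet.pi (Finset.countable_toSet _) fun _ _ => measurableSet_Ioi),
    Measure.infinitePi_pi _ fun _ _ => measurableSet_Ioi]
  simp only [unitInterval.volume_Ioi, Finset.prod_const, Finset.card_map]
  rw [ENNReal.ofReal_pow (sub_nonneg.2 (hp n).2)]

/-- A set of positive measure is missed only by few of the sets from `exists_independent_open`. -/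
theorem eventually_encard_le_of_disjoint {G : ℕ → ℕ → Set ℝ}
    (hG : ∀ n (t : Finset ℕ), volume (Set.Icc 0 1 \ ⋃ i ∈ t, G n i) ≤
      ENNReal.ofReal ((1 - 2⁻¹ ^ n) ^ t.card))
    {K : Set ℝ} (hK : K ⊆ Set.Icc 0 1) (hK0 : volume K ≠ 0) :
    ∀ᶠ n in atTop, {i | Disjoint K (G n i)}.encard ≤ (4 ^ n : ℕ) := by
  have htend : Tendsto (fun n : ℕ => ENNReal.ofReal (Real.exp (-(2 : ℝ) ^ n))) atTop (nhds 0) := by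
    rw [← ENNReal.ofReal_zero]
    refine ENNReal.tendsto_ofReal (Real.tendsto_exp_neg_atTop_nhds_zero.comp ?_)
    exact tendsto_pow_atTop_atTop_of_one_lt one_lt_two
  filter_upwards [htend.eventually (gt_mem_nhds (pos_iff_ne_zero.2 hK0))] with n hn
  by_contra! hcon
  obtain ⟨t', ht', hcard⟩ := Set.exists_subset_encard_eq hcon.le
  have hfin : t'.Finite := Set.finite_of_encard_eq_coe hcard
  have hcard' : hfin.toFinset.card = 4 ^ n := by
    rw [hfin.encard_eq_coe_toFinset_card] at hcard
    exact_mod_cast hcard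
  have hsub : K ⊆ Set.Icc 0 1 \ ⋃ i ∈ hfin.toFinset, G n i := by
    intro r hr
    refine ⟨hK hr, fun hmem => ?_⟩
    obtain ⟨i, hi, hri⟩ := Set.mem_iUnion₂.1 hmem
    exact Set.disjoint_left.1 (ht' (hfin.mem_toFinset.1 hi)) hr hri
  refine absurd hn (not_lt.2 ?_)
  refine (measure_mono hsub).trans ((hG n _).trans (ENNReal.ofReal_le_ofReal ?_))
  rw [hcard']
  have h1 : (2⁻¹ : ℝ) ^ n ≤ 1 := pow_le_one₀ (by norm_num) (by norm_num)
  -- The width `4 ^ n` outweighs `2⁻ⁿ`: the exponent becomes `-2 ^ n`, so the bound tends to zero.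
  calc (1 - (2⁻¹ : ℝ) ^ n) ^ 4 ^ n ≤ Real.exp (-(2⁻¹) ^ n) ^ 4 ^ n :=
        pow_le_pow_left₀ (by linarith) (Real.one_sub_le_exp_neg _) _
    _ = Real.exp (-(2 : ℝ) ^ n) := by
        rw [← Real.exp_nat_mul]
        congr 1
        push_cast
        rw [mul_neg, ← mul_pow]
        norm_num

/-- Countably many slaloms capture all the functions whose associated null set is contained in a
given null set. -/
theorem exists_slaloms_of_null {G : ℕ → ℕ → Set ℝ} (hGo : ∀ n i, IsOpen (G n i))
    (hG : ∀ n (t : Finset ℕ), volume (Set.Icc 0 1 \ ⋃ i ∈ t, G n i) ≤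
      ENNReal.ofReal ((1 - 2⁻¹ ^ n) ^ t.card))
    {N : Set ℝ} (hN : volume N = 0) :
    ∃ s : ℕ → ℕ → Set ℕ, (∀ j n, (s j n).encard ≤ (4 ^ n : ℕ)) ∧
      ∀ x : ℕ → ℕ, {r | ∃ᶠ n in atTop, r ∈ G n (x n)} ⊆ N → ∃ j, ∀ᶠ n in atTop, x n ∈ s j n := by
  classical
  obtain ⟨B, hbasis⟩ := exists_nat_basis
  obtain ⟨O, hNO, hOo, hO⟩ := N.exists_isOpen_lt_of_lt 1 (by rw [hN]; exact one_pos)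
  let K₀ : Set ℝ := Set.Icc 0 1 \ O
  have hK₀c : IsClosed K₀ := isClosed_Icc.sdiff hOo
  have hK₀ : volume K₀ ≠ 0 := by
    intro h0
    have h1 : volume (Set.Icc (0 : ℝ) 1) ≤ volume K₀ + volume O :=
      (measure_mono (fun r hr => by by_cases h : r ∈ O <;> simp [K₀, h, hr] :
        Set.Icc (0 : ℝ) 1 ⊆ K₀ ∪ O)).trans (measure_union_le _ _)
    rw [h0, zero_add, Real.volume_Icc] at h1
    simp only [sub_zero, ENNReal.ofReal_one] at h1
    exact absurd hO (not_lt.2 h1)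
  -- Passing to the support makes every nonempty relatively open piece of `K` have positive measure,
  -- as the counting bound requires.
  let K : Set ℝ := (volume.restrict K₀).support
  have hKc : IsClosed K := Measure.isClosed_support
  have hKK₀ : K ⊆ K₀ := fun r hr => by
    have := (Measure.support_restrict_subset hr).1
    rwa [hK₀c.closure_eq] at this
  have hKne : K.Nonempty := by
    refine Measure.nonempty_support ?_
    rwa [Ne, Measure.restrict_eq_zero]
  have hKpos : ∀ U : Set ℝ, IsOpen U → (K ∩ U).Nonempty → volume (K ∩ U) ≠ 0 := by
    rintro U hU ⟨r, hrK, hrU⟩ h0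
    have h1 : 0 < volume.restrict K₀ U := by
      rw [Measure.mem_support_iff_forall] at hrK
      exact hrK U (hU.mem_nhds hrU)
    have h2 : volume.restrict K₀ U ≤ volume.restrict K₀ (K ∩ U) + volume.restrict K₀ Kᶜ :=
      (measure_mono (fun r hr => by by_cases h : r ∈ K <;> simp [h, hr])).trans
        (measure_union_le _ _)
    rw [Measure.measure_compl_support, add_zero] at h2
    have h3 := h1.trans_le (h2.trans (Measure.restrict_apply_le _ _))
    exact h3.ne' h0
  refine ⟨fun j n => if {i | Disjoint (K ∩ B j) (G n i)}.encard ≤ (4 ^ n : ℕ) then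
    {i | Disjoint (K ∩ B j) (G n i)} else ∅, fun j n => ?_, fun x hx => ?_⟩
  · dsimp only
    split_ifs with h
    · exact h
    · simp
  have : Nonempty K := hKne.to_subtype
  have : CompleteSpace K := hKc.completeSpace_coe
  -- `K` misses `N`, so these closed sets cover it. By Baire one of them contains a nonempty piece
  -- `K ∩ B j`, and from then on `x n` is among the few `i` for which `G n i` misses that piece.
  let Z : ℕ → Set K := fun m => {r | ∀ n ≥ m, (r : ℝ) ∉ G n (x n)}
  have hZc : ∀ m, IsClosed (Z m) := by
    intro m
    have : Z m = ⋂ n ≥ m, (Subtype.val ⁻¹' (G n (x n)))ᶜ := by ext; simp [Z]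
    rw [this]
    exact isClosed_biInter fun n _ =>
      ((hGo n (x n)).preimage continuous_subtype_val).isClosed_compl
  have hZ : ⋃ m, Z m = Set.univ := by
    refine Set.eq_univ_of_forall fun r => ?_
    have hr : ¬ ∃ᶠ n in atTop, (r : ℝ) ∈ G n (x n) := fun h => (hKK₀ r.2).2 (hNO (hx h))
    obtain ⟨m, hm⟩ := eventually_atTop.1 (not_frequently.1 hr)
    exact Set.mem_iUnion.2 ⟨m, hm⟩
  obtain ⟨m, r, hr⟩ := nonempty_interior_of_iUnion_of_closed hZc hZ
  obtain ⟨V, hVZ, hVo, hrV⟩ := mem_interior.1 hr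
  obtain ⟨U, hUo, rfl⟩ := isOpen_induced_iff.1 hVo
  obtain ⟨W, hW, hrW, hWU⟩ := hbasis.exists_subset_of_mem_open (Set.mem_preimage.1 hrV) hUo
  have hWo := hbasis.isOpen hW
  obtain ⟨j, rfl⟩ := hW
  refine ⟨j, ?_⟩
  filter_upwards [eventually_encard_le_of_disjoint hG
    (fun r hr => (hKK₀ hr.1).1 : K ∩ B j ⊆ Set.Icc 0 1) (hKpos _ hWo ⟨r, r.2, hrW⟩),
    eventually_ge_atTop m] with n hn hmn
  rw [if_pos hn]
  refine Set.disjoint_left.2 fun q hq hqG => ?_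
  exact hVZ (show (⟨q, hq.1⟩ : K) ∈ Subtype.val ⁻¹' U from hWU hq.2) n hmn hqG

/-- Needed to absorb the countably many slaloms obtained from each null set. -/
theorem infinite_of_null_cofinal {D : Set {A : Set ℝ // volume A = 0}}
    (hD : ∀ A : {A : Set ℝ // volume A = 0}, ∃ B ∈ D, A.1 ⊆ B.1) : D.Infinite := by
  intro hfin
  have hnull : volume (⋃ B ∈ D, B.1) = 0 :=
    (measure_biUnion_null_iff hfin.countable).2 fun B _ => B.2
  have hne : (⋃ B ∈ D, B.1) ≠ Set.univ := by
    intro h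
    rw [h, Real.volume_univ] at hnull
    exact ENNReal.top_ne_zero hnull
  obtain ⟨r, hr⟩ := (Set.ne_univ_iff_exists_notMem _).1 hne
  obtain ⟨B, hB, hrB⟩ := hD ⟨{r}, by simp⟩
  exact hr (Set.mem_biUnion hB (hrB rfl))

theorem slt_boundedBy_four_pow_le_cofNull :
    slt (boundedBy (fun _ => ℕ) fun n => 4 ^ n) FinIdeal ≤ cofNull := by
  obtain ⟨G, hGo, hGv, hG⟩ := exists_independent_open
  refine minCard_le_minCard ?_
  rintro _ ⟨D, hD, rfl⟩
  have hinf := infinite_of_null_cofinal hD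
  choose s hs hsx using fun N : {A : Set ℝ // volume A = 0} => exists_slaloms_of_null hGo hG N.2
  refine ⟨_, ⟨Set.range fun p : D × ℕ => s p.1 p.2, ?_, fun x => ?_, rfl⟩, ?_⟩
  · rintro _ ⟨p, rfl⟩ n
    exact hs _ _ _
  · have hnull : volume {r | ∃ᶠ n in atTop, r ∈ G n (x n)} = 0 := by
      refine measure_setOfPred_frequently_eq_zero (p := fun n r => r ∈ G n (x n)) ?_
      exact ne_top_of_le_ne_top (tsum_half_pow_ne_top 2 (by simp))
        (ENNReal.tsum_le_tsum fun n => hGv n _)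
    obtain ⟨N, hN, hsub⟩ := hD ⟨_, hnull⟩
    obtain ⟨j, hj⟩ := hsx N x hsub
    exact ⟨_, ⟨(⟨N, hN⟩, j), rfl⟩, mem_dualFamily_finIdeal.2 hj⟩
  · refine mk_range_le.trans ?_
    rw [mk_prod, lift_id, lift_id, mk_nat]
    have h1 : ℵ₀ ≤ #D := infinite_iff.1 hinf.to_subtype
    exact (mul_le_mul_right h1 _).trans (mul_eq_self h1).le

/-- For widths tending to infinity, localization does not depend on the width. -/
theorem slt_boundedBy_le_of_tendsto {g : ℕ → ℕ} (hg : Tendsto g atTop atTop) (h : ℕ → ℕ) :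
    slt (boundedBy (fun _ => ℕ) g) FinIdeal ≤ slt (boundedBy (fun _ => ℕ) h) FinIdeal := by
  classical
  obtain ⟨c⟩ : Nonempty (ℕ ≃ List ℕ) := nonempty_equiv_of_countable
  -- `k n` is the largest index up to `n` whose width `h` fits into `g n`; it tends to infinity with
  -- `g`.
  let k : ℕ → ℕ := fun n => Nat.findGreatest (fun k => h k ≤ g n) n
  have hk : Tendsto k atTop atTop := by
    refine tendsto_atTop.2 fun K => ?_
    filter_upwards [eventually_ge_atTop K, hg.eventually_ge_atTop (h K)] with n h1 h2
    exact Nat.le_findGreatest h1 h2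
  have hkg : ∀ᶠ n in atTop, h (k n) ≤ g n := by
    filter_upwards [hg.eventually_ge_atTop (h 0)] with n hn
    exact Nat.findGreatest_spec (P := fun k => h k ≤ g n) (Nat.zero_le n) hn
  have hbound : ∀ K, ∃ N, ∀ n, k n ≤ K → n < N := by
    intro K
    obtain ⟨N, hN⟩ := eventually_atTop.1 (hk.eventually_gt_atTop K)
    exact ⟨N, fun n hn => by by_contra! hc; exact absurd (hN n hc) (not_lt.2 hn)⟩
  choose N hN using hbound
  refine minCard_le_minCard ?_
  rintro _ ⟨S, hS, hdom, rfl⟩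
  refine ⟨_, ⟨(fun s n => if h (k n) ≤ g n then (fun m => (c m).getD n 0) '' s (k n) else ∅) '' S,
    ?_, fun x => ?_, rfl⟩, mk_image_le⟩
  · rintro _ ⟨s, hs, rfl⟩ n
    dsimp only
    split_ifs with hn
    · exact (Set.encard_image_le _ _).trans ((hS s hs _).trans (by exact_mod_cast hn))
    · simp
  · obtain ⟨s, hs, hx⟩ := hdom fun K => c.symm (initialSegment x (N K))
    rw [mem_dualFamily_finIdeal] at hx
    refine ⟨_, ⟨s, hs, rfl⟩, mem_dualFamily_finIdeal.2 ?_⟩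
    filter_upwards [hk.eventually hx, hkg] with n hn hkn
    simp only [if_pos hkn]
    refine ⟨_, hn, ?_⟩
    simp only [Equiv.apply_symm_apply, initialSegment]
    rw [List.getD_eq_getElem _ _ (by simpa using hN (k n) n le_rfl)]
    rw [List.getElem_map]
    exact congrArg x (List.getElem_range _)

theorem slt_boundedBy_eq_cofNull {g : ℕ → ℕ} (hg : Tendsto g atTop atTop) :
    slt (boundedBy (fun _ => ℕ) g) FinIdeal = cofNull :=
  ((slt_boundedBy_le_of_tendsto hg _).trans slt_boundedBy_four_pow_le_cofNull).antisymm
    (cofNull_le_slt_boundedBy g)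

end SlalomNumbers

/-! ### The corollary. -/

theorem mainTheorem11 (I J : Set (Set ℕ)) (hI : IsIdealOn I) (hJ : IsIdealOn J)
    (g h : ℕ → ℕ) (hg : Tendsto g atTop atTop) (hh : ∀ᶠ n in atTop, 1 ≤ h n)
    (b : ℕ → Type u) [∀ n, Nonempty (b n)] :
    (nonS1 (GammaH h) FinIdeal = nonMeager ∧
      nonS1 (GammaH g) (large FinIdeal) = cofNull) ∧
    (nonS1 (GammaH h) J = sle (boundedBy (fun _ => ℕ) h) J ∧
      nonS1 (GammaH h) (large J) = slt (boundedBy (fun _ => ℕ) h) J) ∧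
    (nonS1 (GammaBH b h) J = sle (boundedBy b h) J ∧
      nonS1 (GammaBH b h) (large J) = slt (boundedBy b h) J) ∧
    (nonS1 Gamma J = boundingNumberMod J ∧
      nonS1 Gamma (large J) = dominatingNumberMod J) ∧
    (nonS1 (valuedIn I) J = sle (valuedIn I) J ∧
      nonS1 (valuedIn I) (large J) = slt (valuedIn I) J) ∧
    (nonS1 Omega J = sle (coordFUP fun _ => ℕ) J ∧
      nonS1 Omega (large J) = slt (coordFUP fun _ => ℕ) J) ∧
    -- for `J = Fin`, the family `Fin`-`Λ` can be replaced by `𝒪`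
    ((∀ n, g n ≠ 0) → nonS1 (GammaH g) openCover = cofNull) ∧
    ((∀ n, h n ≠ 0) →
      nonS1 (GammaH h) openCover = slt (boundedBy (fun _ => ℕ) h) FinIdeal) ∧
    ((∀ n, h n ≠ 0) → (∀ n, Countable (b n)) → (∃ᶠ n in atTop, (h n : Cardinal) < #(b n)) →
      nonS1 (GammaBH b h) openCover = slt (boundedBy b h) FinIdeal) ∧
    nonS1 Gamma openCover = dominatingNumberMod FinIdeal ∧
    nonS1 (valuedIn I) openCover = slt (valuedIn I) FinIdeal ∧
    nonS1 Omega openCover = slt (coordFUP fun _ => ℕ) FinIdeal := by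
  have hsl : slt (boundedBy (fun _ => ℕ) g) FinIdeal = cofNull := slt_boundedBy_eq_cofNull hg
  have hdom : nonS1 Gamma openCover = dominatingNumberMod FinIdeal :=
    (nonS1_valuedIn_openCover isIdealOn_finIdeal).trans
      (slt_finIdeal_eq_dominatingNumberMod isIdealOn_finIdeal)
  exact ⟨⟨nonS1_boundedBy_eq_nonMeager hh, (nonS1_large_eq_slt _ _).trans hsl⟩,
    ⟨nonS1_eq_sle _ _, nonS1_large_eq_slt _ _⟩,
    ⟨nonS1_eq_sle _ _, nonS1_large_eq_slt _ _⟩,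
    ⟨(nonS1_eq_sle _ _).trans (sle_finIdeal_eq_boundingNumberMod hJ),
      (nonS1_large_eq_slt _ _).trans (slt_finIdeal_eq_dominatingNumberMod hJ)⟩,
    ⟨nonS1_eq_sle _ _, nonS1_large_eq_slt _ _⟩,
    ⟨nonS1_eq_sle _ _, nonS1_large_eq_slt _ _⟩,
    fun h0 => (nonS1_boundedBy_nat_openCover h0).trans hsl,
    nonS1_boundedBy_nat_openCover,
    fun h0 _ hb => nonS1_boundedBy_openCover h0 hb,
    hdom, nonS1_valuedIn_openCover hI, nonS1_coordFUP_openCover⟩
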